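/- Conventions. For an element $x$ of a semigroup $S$, $V(x)=\{y\in S : xyx=x,\ yxy=y\}$ is its set of inverses. $S$ is an inverse semigroup if $|V(x)|=1$ for all $x$ (then $V(x)=\{x^{-1}\}$); it is orthodox if it is regular (for every $x$ there is $y$ with $xyx=x$) and its idempotents form a subsemigroup. An inverse subsemigroup $T$ of $S$ is an inverse transversal of $S$ if $|T\cap V(x)|=1$ for all $x\in S$, and is a quasi-ideal if $TST\subseteq T$. A band (semigroup of idempotents) is left normal if $xyz=xzy$ holds in it and right normal if $xyz=yxz$ holds in it. $L_a$ and $R_a$ denote the classes of $a$ under Green's relations $\mathcal L$ and $\mathcal R$. A subsemigroup $E$ of a band $B$ that is a semilattice is a semilattice transversal of $B$ if $|E\cap V(b)|=1$ for all $b\in B$. Construction. Let $S^0$ be an inverse semigroup with semilattice of idempotents $E^0$, let $I=\bigcup_{x\in E^0}L_x$ be a left normal band and $\Lambda=\bigcup_{x\in E^0}R_x$ a right normal band, with $E^0$ (embedded as a subsemigroup in each of $I$ and $\Lambda$) a common semilattice transversal of $I$ and $\Lambda$; here $L_x$ is taken in $I$ and $R_x$ in $\Lambda$. Let $$W=\{(e,x,f)\in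 I\times S^0\times\Lambda : e\in L_{xx^{-1}},\ f\in R_{x^{-1}x}\}$$ with multiplication $$(e,x,f)(g,y,h)=\bigl(e(xy)(xy)^{-1},\ xy,\ (xy)^{-1}(xy)h\bigr).$$ Corollary. (1) For all $S^0$, $I$, $\Lambda$ as above, $W$ is an orthodox semigroup, and $W^0=\{(xx^{-1},x,x^{-1}x) : x\in S^0\}$ is a quasi-ideal inverse transversal of $W$, isomorphic to $S^0$ via $x\mapsto (xx^{-1},x,x^{-1}x)$. (2) Conversely, let $S$ be an orthodox semigroup with a quasi-ideal inverse transversal $S^0$, and let $E^0$ be the semilattice of idempotents of $S^0$. Then there are a left normal band $I=\bigcup_{x\in E^0}L_x$ and a right normal band $\Lambda=\bigcup_{x\in E^0}R_x$ with common semilattice transversal $E^0$, and an isomorphism from $S$ onto the semigroup $W$ constructed from $S^0$, $I$, $\Lambda$ that sends each $x\in S^0$ to $(xx^{-1},x,x^{-1}x)$. -/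

import Mathlib

universe u v w z


/-- `b` is an inverse of `a` in the semigroup sense, i.e. `b ∈ V(a)`. -/
def IsInverseOf {S : Type*} [Semigroup S] (a b : S) : Prop :=
  a * b * a = a ∧ b * a * b = b

/-- Inverse semigroups: every element has exactly one inverse. -/
class IsInverseSemigroup (S : Type*) [Semigroup S] : Prop where
  existsUnique_inverse : ∀ a : S, ∃! b : S, IsInverseOf a b

/-- The unique inverse `x⁻¹` of an element of an inverse semigroup. -/
noncomputable def sinv {S : Type*} [Semigroup S] [IsInverseSemigroup S] (x : S) : S :=
  (IsInverseSemigroup.existsUnique_inverse x).choose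

theorem sinv_spec {S : Type*} [Semigroup S] [IsInverseSemigroup S] (x : S) :
    IsInverseOf x (sinv x) :=
  (IsInverseSemigroup.existsUnique_inverse x).choose_spec.1

theorem eq_of_isInverseOf {S : Type*} [Semigroup S] [IsInverseSemigroup S] {x a b : S}
    (ha : IsInverseOf x a) (hb : IsInverseOf x b) : a = b :=
  (IsInverseSemigroup.existsUnique_inverse x).unique ha hb

theorem isIdempotentElem_mul_of_inverse {S : Type*} [Semigroup S] [IsInverseSemigroup S]
    {e f : S} (he : IsIdempotentElem e) (hf : IsIdempotentElem f) :
    IsIdempotentElem (e * f) := by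
  obtain ⟨h1, h2⟩ := sinv_spec (e * f)
  set a := sinv (e * f) with ha
  have he' : ∀ z, e * (e * z) = e * z := fun z => by rw [← mul_assoc, he.eq]
  have hf' : ∀ z, f * (f * z) = f * z := fun z => by rw [← mul_assoc, hf.eq]
  simp only [mul_assoc] at h1 h2
  have h2' : ∀ z, a * (e * (f * (a * z))) = a * z := fun z => by
    have := congrArg (· * z) h2
    simpa only [mul_assoc] using this
  have h3 : IsInverseOf (e * f) (f * a * e) := by
    constructor
    · simp only [mul_assoc, he', hf', h1]
    · simp only [mul_assoc, he', hf', h2']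
  have h4 : f * a * e = a := eq_of_isInverseOf h3 (sinv_spec (e * f))
  have h5 : a * a = a := by
    calc a * a = (f * a * e) * (f * a * e) := by rw [h4]
      _ = f * a * e := by simp only [mul_assoc, h2']
      _ = a := h4
  have h6 : IsInverseOf a (e * f) := ⟨by simpa only [mul_assoc] using h2,
    by simpa only [mul_assoc] using h1⟩
  have h7 : IsInverseOf a a := ⟨by rw [h5, h5], by rw [h5, h5]⟩
  have h8 : e * f = a := eq_of_isInverseOf h6 h7
  rw [h8]
  exact h5

/-- The semilattice of idempotents `E(S)` of an inverse semigroup `S`. -/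
def idemSubsemigroup (S : Type*) [Semigroup S] [IsInverseSemigroup S] : Subsemigroup S where
  carrier := {e | IsIdempotentElem e}
  mul_mem' := isIdempotentElem_mul_of_inverse

/-- The idempotent `x⁺ = x x⁻¹`. -/
noncomputable def leftIdem {S : Type*} [Semigroup S] [IsInverseSemigroup S] (x : S) :
    idemSubsemigroup S :=
  ⟨x * sinv x, by
    change x * sinv x * (x * sinv x) = x * sinv x
    rw [← mul_assoc, (sinv_spec x).1]⟩

/-- The idempotent `x* = x⁻¹ x`. -/
noncomputable def rightIdem {S : Type*} [Semigroup S] [IsInverseSemigroup S] (x : S) :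
    idemSubsemigroup S :=
  ⟨sinv x * x, by
    change sinv x * x * (sinv x * x) = sinv x * x
    rw [← mul_assoc, (sinv_spec x).2]⟩

/-- Orthodox semigroups: regular semigroups whose idempotents form a subsemigroup. -/
def IsOrthodox (S : Type*) [Semigroup S] : Prop :=
  (∀ a : S, ∃ b : S, a * b * a = a) ∧
    ∀ e f : S, IsIdempotentElem e → IsIdempotentElem f → IsIdempotentElem (e * f)

/-- `T` is an inverse transversal of `S`: an inverse subsemigroup that contains exactly one
inverse of each element of `S`. -/
class IsInverseTransversal {S : Type*} [Semigroup S] (T : Subsemigroup S) : Prop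
    extends IsInverseSemigroup T where
  existsUnique_mem : ∀ x : S, ∃! y : S, y ∈ T ∧ IsInverseOf x y

/-- `T` is a quasi-ideal of `S`: `T S T ⊆ T`. -/
def IsQuasiIdeal {S : Type*} [Semigroup S] (T : Subsemigroup S) : Prop :=
  ∀ a ∈ T, ∀ s : S, ∀ b ∈ T, a * s * b ∈ T

/-- Left normal bands. -/
def IsLeftNormalBand (B : Type*) [Semigroup B] : Prop :=
  (∀ x : B, x * x = x) ∧ ∀ x y z : B, x * y * z = x * z * y

/-- Right normal bands. -/
def IsRightNormalBand (B : Type*) [Semigroup B] : Prop :=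
  (∀ x : B, x * x = x) ∧ ∀ x y z : B, x * y * z = y * x * z

/-- Green's relation `L`: equality of the principal left ideals `S¹a` and `S¹b`. -/
def GreenL {S : Type*} [Semigroup S] (a b : S) : Prop :=
  (a = b ∨ ∃ u, a = u * b) ∧ (b = a ∨ ∃ v, b = v * a)

/-- Green's relation `R`: equality of the principal right ideals `aS¹` and `bS¹`. -/
def GreenR {S : Type*} [Semigroup S] (a b : S) : Prop :=
  (a = b ∨ ∃ u, a = b * u) ∧ (b = a ∨ ∃ v, b = a * v)

/-- Via the embedding `ι`, the semilattice `E` is a (semilattice) transversal of `B`: it is a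
subsemigroup containing exactly one inverse of each element of `B`. -/
def IsSemilatticeTransversal {E B : Type*} [Semigroup E] [Semigroup B] (ι : E →ₙ* B) : Prop :=
  Function.Injective ι ∧ ∀ x : B, ∃! e : E, IsInverseOf x (ι e)

theorem GreenL.mul_right {S : Type*} [Semigroup S] {a b : S} (h : GreenL a b) (c : S) :
    GreenL (a * c) (b * c) := by
  obtain ⟨h1, h2⟩ := h
  refine ⟨h1.imp ?_ ?_, h2.imp ?_ ?_⟩
  · rintro rfl; rfl
  · rintro ⟨u, rfl⟩; exact ⟨u, mul_assoc _ _ _⟩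
  · rintro rfl; rfl
  · rintro ⟨u, rfl⟩; exact ⟨u, mul_assoc _ _ _⟩

theorem GreenR.mul_left {S : Type*} [Semigroup S] {a b : S} (h : GreenR a b) (c : S) :
    GreenR (c * a) (c * b) := by
  obtain ⟨h1, h2⟩ := h
  refine ⟨h1.imp ?_ ?_, h2.imp ?_ ?_⟩
  · rintro rfl; rfl
  · rintro ⟨u, rfl⟩; exact ⟨u, (mul_assoc _ _ _).symm⟩
  · rintro rfl; rfl
  · rintro ⟨u, rfl⟩; exact ⟨u, (mul_assoc _ _ _).symm⟩

theorem leftIdem_mul {S : Type*} [Semigroup S] [IsInverseSemigroup S] (x y : S) :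
    leftIdem x * leftIdem (x * y) = leftIdem (x * y) := by
  apply Subtype.ext
  change x * sinv x * (x * y * sinv (x * y)) = x * y * sinv (x * y)
  rw [← mul_assoc, ← mul_assoc, (sinv_spec x).1]

theorem rightIdem_mul {S : Type*} [Semigroup S] [IsInverseSemigroup S] (x y : S) :
    rightIdem (x * y) * rightIdem y = rightIdem (x * y) := by
  apply Subtype.ext
  change sinv (x * y) * (x * y) * (sinv y * y) = sinv (x * y) * (x * y)
  have h := (sinv_spec y).1
  simp only [mul_assoc] at h ⊢
  rw [h]

/-- The set `W` of triples `(e, x, f) ∈ I × S⁰ × Λ` with `e ∈ L_{x x⁻¹}` and `f ∈ R_{x⁻¹ x}`,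
where the idempotents of `S⁰` are embedded in `I` by `ιI` and in `Λ` by `ιΛ`. -/
@[ext]
structure TripleProduct {S₀ I Λ : Type*} [Semigroup S₀] [IsInverseSemigroup S₀]
    [Semigroup I] [Semigroup Λ]
    (ιI : idemSubsemigroup S₀ →ₙ* I) (ιΛ : idemSubsemigroup S₀ →ₙ* Λ) where
  left : I
  mid : S₀
  right : Λ
  left_mem : GreenL left (ιI (leftIdem mid))
  right_mem : GreenR right (ιΛ (rightIdem mid))

/-- The multiplication `(e, x, f)(g, y, h) = (e (xy)(xy)⁻¹, xy, (xy)⁻¹(xy) h)` on `W`. -/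
noncomputable instance TripleProduct.instSemigroup {S₀ I Λ : Type*} [Semigroup S₀]
    [IsInverseSemigroup S₀] [Semigroup I] [Semigroup Λ]
    (ιI : idemSubsemigroup S₀ →ₙ* I) (ιΛ : idemSubsemigroup S₀ →ₙ* Λ) :
    Semigroup (TripleProduct ιI ιΛ) where
  mul p q :=
    { left := p.left * ιI (leftIdem (p.mid * q.mid))
      mid := p.mid * q.mid
      right := ιΛ (rightIdem (p.mid * q.mid)) * q.right
      left_mem := by
        have h := p.left_mem.mul_right (ιI (leftIdem (p.mid * q.mid)))
        rwa [← map_mul, leftIdem_mul] at h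
      right_mem := by
        have h := q.right_mem.mul_left (ιΛ (rightIdem (p.mid * q.mid)))
        rwa [← map_mul, rightIdem_mul] at h }
  mul_assoc p q r := by
    apply TripleProduct.ext
    · change p.left * ιI (leftIdem (p.mid * q.mid)) * ιI (leftIdem (p.mid * q.mid * r.mid)) =
        p.left * ιI (leftIdem (p.mid * (q.mid * r.mid)))
      rw [mul_assoc, ← map_mul, leftIdem_mul, mul_assoc]
    · exact mul_assoc _ _ _
    · change ιΛ (rightIdem (p.mid * q.mid * r.mid)) * r.right =
        ιΛ (rightIdem (p.mid * (q.mid * r.mid))) * (ιΛ (rightIdem (q.mid * r.mid)) * r.right)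
      rw [← mul_assoc, ← map_mul, rightIdem_mul, mul_assoc]

/-- The triple `(x x⁻¹, x, x⁻¹ x) ∈ W` of an element `x ∈ S⁰`. -/
noncomputable def TripleProduct.diag {S₀ I Λ : Type*} [Semigroup S₀] [IsInverseSemigroup S₀]
    [Semigroup I] [Semigroup Λ]
    (ιI : idemSubsemigroup S₀ →ₙ* I) (ιΛ : idemSubsemigroup S₀ →ₙ* Λ) (x : S₀) :
    TripleProduct ιI ιΛ where
  left := ιI (leftIdem x)
  mid := x
  right := ιΛ (rightIdem x)
  left_mem := ⟨Or.inl rfl, Or.inl rfl⟩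
  right_mem := ⟨Or.inl rfl, Or.inl rfl⟩

/-- The data of the construction: `I` is a left normal band that is the union of the `L`-classes
of the elements of `E(S⁰)`, `Λ` is a right normal band that is the union of the `R`-classes of the
elements of `E(S⁰)`, and `E(S⁰)` is a common semilattice transversal of `I` and `Λ`. -/
structure IsNormalBandPair {S₀ I Λ : Type*} [Semigroup S₀] [IsInverseSemigroup S₀]
    [Semigroup I] [Semigroup Λ]
    (ιI : idemSubsemigroup S₀ →ₙ* I) (ιΛ : idemSubsemigroup S₀ →ₙ* Λ) : Prop where
  left_normal : IsLeftNormalBand I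
  right_normal : IsRightNormalBand Λ
  left_union : ∀ i : I, ∃ e, GreenL i (ιI e)
  right_union : ∀ l : Λ, ∃ e, GreenR l (ιΛ e)
  left_transversal : IsSemilatticeTransversal ιI
  right_transversal : IsSemilatticeTransversal ιΛ

/-! In `W` the outer coordinates of a product are determined up to absorption by the middle one.
Since `e` already absorbs `x x⁻¹` on the right and `f` absorbs `x⁻¹ x` on the left, an element is
idempotent, or two are mutually inverse, exactly when this holds for the middle coordinates in `S⁰`
(`isIdempotentElem_iff`, `isInverseOf_iff`). Orthodoxy and the transversal property of `W⁰` are thus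
pulled back from `S⁰`.

Conversely, write `x°` for the inverse of `x` in the transversal. Orthodoxy gives `(xy)° = y° x°`
(`tinv_mul`), and the quasi-ideal property then gives `a s b = a s°° b` for `a`, `b` in the
transversal (`mul_mul_eq`): a sandwiched element matters only through its double inverse. For
idempotents this makes `{e : e e° = e}` and `{f : f° f = f}` left and right normal bands, and it
makes `x ↦ (x x°, x°°, x° x)` a homomorphism with inverse `(e, x, f) ↦ e x f`. -/

/-! ### Inverses, Green's relations and commuting idempotents. -/

section InverseSemigroup

variable {S : Type*} [Semigroup S]

theorem IsInverseOf.symm {a b : S} (h : IsInverseOf a b) : IsInverseOf b a :=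
  ⟨h.2, h.1⟩

theorem IsInverseOf.isIdempotentElem_mul {a b : S} (h : IsInverseOf a b) :
    IsIdempotentElem (a * b) := by
  change a * b * (a * b) = a * b
  rw [← mul_assoc, h.1]

theorem GreenL.mul_eq_left {a b : S} (h : GreenL a b) (hb : IsIdempotentElem b) : a * b = a := by
  rcases h.1 with rfl | ⟨u, rfl⟩
  · exact hb
  · rw [mul_assoc, hb.eq]

theorem GreenR.mul_eq_left {a b : S} (h : GreenR a b) (hb : IsIdempotentElem b) : b * a = a := by
  rcases h.1 with rfl | ⟨u, rfl⟩
  · exact hb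
  · rw [← mul_assoc, hb.eq]

theorem GreenL.symm {a b : S} (h : GreenL a b) : GreenL b a := ⟨h.2, h.1⟩

theorem GreenR.symm {a b : S} (h : GreenR a b) : GreenR b a := ⟨h.2, h.1⟩

theorem greenL_of_mul_eq {a b : S} (hab : a * b = a) (hba : b * a = b) : GreenL a b :=
  ⟨Or.inr ⟨a, hab.symm⟩, Or.inr ⟨b, hba.symm⟩⟩

theorem greenR_of_mul_eq {a b : S} (hab : a * b = b) (hba : b * a = a) : GreenR a b :=
  ⟨Or.inr ⟨a, hba.symm⟩, Or.inr ⟨b, hab.symm⟩⟩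

theorem IsInverseOf.map {T : Type*} [Semigroup T] (φ : S →ₙ* T) {a b : S} (h : IsInverseOf a b) :
    IsInverseOf (φ a) (φ b) := by
  constructor
  · rw [← map_mul, ← map_mul, h.1]
  · rw [← map_mul, ← map_mul, h.2]

theorem IsInverseSemigroup.of_mulEquiv {T : Type*} [Semigroup T] [IsInverseSemigroup S]
    (φ : S ≃* T) : IsInverseSemigroup T where
  existsUnique_inverse t := by
    refine ⟨φ (sinv (φ.symm t)), ?_, fun y hy => ?_⟩
    · simpa using (sinv_spec (φ.symm t)).map (φ : S →ₙ* T)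
    · rw [← φ.symm_apply_eq]
      exact eq_of_isInverseOf (hy.map (φ.symm : T →ₙ* S)) (sinv_spec _)

variable [IsInverseSemigroup S]

theorem sinv_sinv (x : S) : sinv (sinv x) = x :=
  eq_of_isInverseOf (sinv_spec _) (sinv_spec x).symm

theorem sinv_eq_self {e : S} (he : IsIdempotentElem e) : sinv e = e :=
  eq_of_isInverseOf (sinv_spec e) ⟨by rw [he.eq, he.eq], by rw [he.eq, he.eq]⟩

/-- `f * e` is an inverse of `e * f`, and so is the idempotent `e * f` itself; inverses are unique.
-/
theorem IsIdempotentElem.mul_comm_of_inverse {e f : S} (he : IsIdempotentElem e)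
    (hf : IsIdempotentElem f) : e * f = f * e := by
  have hef := isIdempotentElem_mul_of_inverse he hf
  have hfe := isIdempotentElem_mul_of_inverse hf he
  have h : IsInverseOf (e * f) (f * e) := by
    simp only [IsIdempotentElem, ← mul_assoc] at hef hfe he hf
    constructor
    · rw [← mul_assoc, ← mul_assoc, mul_assoc e f f, hf, mul_assoc (e * f) e e, he, hef]
    · rw [← mul_assoc, ← mul_assoc, mul_assoc f e e, he, mul_assoc (f * e) f f, hf, hfe]
  exact (eq_of_isInverseOf h (sinv_spec _) |>.trans (sinv_eq_self hef)).symm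

theorem isIdempotentElem_idem (e : idemSubsemigroup S) : IsIdempotentElem e :=
  Subtype.ext e.2

theorem leftIdem_sinv (x : S) : leftIdem (sinv x) = rightIdem x :=
  Subtype.ext (by change sinv x * sinv (sinv x) = sinv x * x; rw [sinv_sinv])

theorem rightIdem_sinv (x : S) : rightIdem (sinv x) = leftIdem x :=
  Subtype.ext (by change sinv (sinv x) * sinv x = x * sinv x; rw [sinv_sinv])

end InverseSemigroup

/-! ### The semigroup `W` and its transversal `W⁰`. -/

namespace TripleProduct

variable {S₀ I Λ : Type*} [Semigroup S₀] [IsInverseSemigroup S₀] [Semigroup I] [Semigroup Λ]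
  {ιI : idemSubsemigroup S₀ →ₙ* I} {ιΛ : idemSubsemigroup S₀ →ₙ* Λ}

theorem mul_left (p q : TripleProduct ιI ιΛ) :
    (p * q).left = p.left * ιI (leftIdem (p.mid * q.mid)) := rfl

theorem mul_mid (p q : TripleProduct ιI ιΛ) : (p * q).mid = p.mid * q.mid := rfl

theorem mul_right (p q : TripleProduct ιI ιΛ) :
    (p * q).right = ιΛ (rightIdem (p.mid * q.mid)) * q.right := rfl

theorem left_mul_leftIdem (p : TripleProduct ιI ιΛ) : p.left * ιI (leftIdem p.mid) = p.left :=
  p.left_mem.mul_eq_left ((isIdempotentElem_idem _).map ιI)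

theorem rightIdem_mul_right (p : TripleProduct ιI ιΛ) :
    ιΛ (rightIdem p.mid) * p.right = p.right :=
  p.right_mem.mul_eq_left ((isIdempotentElem_idem _).map ιΛ)

theorem isIdempotentElem_iff (p : TripleProduct ιI ιΛ) :
    IsIdempotentElem p ↔ IsIdempotentElem p.mid := by
  refine ⟨fun h => congrArg mid h, fun h => ?_⟩
  apply TripleProduct.ext
  · rw [mul_left, h.eq, left_mul_leftIdem]
  · exact h
  · rw [mul_right, h.eq, rightIdem_mul_right]

/-- Under `h` the idempotents multiplied onto the outer coordinates of `p` reduce to those of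
`p.mid`, which these coordinates absorb. -/
theorem mul_mul_eq_self {p q : TripleProduct ιI ιΛ} (h : p.mid * q.mid * p.mid = p.mid) :
    p * q * p = p := by
  apply TripleProduct.ext
  · rw [mul_left, mul_left, mul_mid, h, mul_assoc, ← map_mul]
    have : leftIdem (p.mid * q.mid) * leftIdem p.mid = leftIdem p.mid := by
      simpa only [h] using leftIdem_mul (p.mid * q.mid) p.mid
    rw [this, left_mul_leftIdem]
  · exact h
  · rw [mul_right, mul_mid, h, rightIdem_mul_right]

theorem isInverseOf_iff (p q : TripleProduct ιI ιΛ) :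
    IsInverseOf p q ↔ IsInverseOf p.mid q.mid :=
  ⟨fun h => ⟨congrArg mid h.1, congrArg mid h.2⟩,
    fun h => ⟨mul_mul_eq_self h.1, mul_mul_eq_self h.2⟩⟩

theorem isOrthodox : IsOrthodox (TripleProduct ιI ιΛ) := by
  refine ⟨fun p => ⟨diag ιI ιΛ (sinv p.mid), ?_⟩, fun p q hp hq => ?_⟩
  · exact mul_mul_eq_self (sinv_spec p.mid).1
  · rw [isIdempotentElem_iff] at hp hq ⊢
    exact isIdempotentElem_mul_of_inverse hp hq

theorem diag_mul (x y : S₀) : diag ιI ιΛ (x * y) = diag ιI ιΛ x * diag ιI ιΛ y := by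
  apply TripleProduct.ext
  · change ιI (leftIdem (x * y)) = ιI (leftIdem x) * ιI (leftIdem (x * y))
    rw [← map_mul, leftIdem_mul]
  · rfl
  · change ιΛ (rightIdem (x * y)) = ιΛ (rightIdem (x * y)) * ιΛ (rightIdem y)
    rw [← map_mul, rightIdem_mul]

/-- A product keeps only the first left and the last right coordinate, so the outer coordinates of
`p` disappear. This is the quasi-ideal property of `W⁰`. -/
theorem diag_mul_mul_diag (x y : S₀) (p : TripleProduct ιI ιΛ) :
    diag ιI ιΛ x * p * diag ιI ιΛ y = diag ιI ιΛ (x * p.mid * y) := by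
  apply TripleProduct.ext
  · change ιI (leftIdem x) * ιI (leftIdem (x * p.mid)) * ιI (leftIdem (x * p.mid * y)) =
      ιI (leftIdem (x * p.mid * y))
    rw [← map_mul, leftIdem_mul, ← map_mul, leftIdem_mul]
  · rfl
  · change ιΛ (rightIdem (x * p.mid * y)) * ιΛ (rightIdem y) = ιΛ (rightIdem (x * p.mid * y))
    rw [← map_mul, rightIdem_mul]

/-- The embedding `x ↦ (x x⁻¹, x, x⁻¹ x)` of `S⁰` into `W` as a homomorphism. -/
noncomputable def diagHom (ιI : idemSubsemigroup S₀ →ₙ* I) (ιΛ : idemSubsemigroup S₀ →ₙ* Λ) :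
    S₀ →ₙ* TripleProduct ιI ιΛ where
  toFun := diag ιI ιΛ
  map_mul' := diag_mul

/-- The isomorphism of `S⁰` onto its image `W⁰` in `W`. -/
noncomputable def diagEquiv (ιI : idemSubsemigroup S₀ →ₙ* I) (ιΛ : idemSubsemigroup S₀ →ₙ* Λ) :
    S₀ ≃* (diagHom ιI ιΛ).srange where
  toFun x := ⟨diag ιI ιΛ x, x, rfl⟩
  invFun p := p.1.mid
  left_inv _ := rfl
  right_inv := by
    rintro ⟨_, x, rfl⟩
    rfl
  map_mul' x y := Subtype.ext (diag_mul x y)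

theorem isInverseTransversal_srange : IsInverseTransversal (diagHom ιI ιΛ).srange where
  toIsInverseSemigroup := .of_mulEquiv (diagEquiv ιI ιΛ)
  existsUnique_mem p := by
    refine ⟨diag ιI ιΛ (sinv p.mid), ⟨⟨_, rfl⟩, ?_⟩, ?_⟩
    · exact (isInverseOf_iff _ _).2 (sinv_spec p.mid)
    · rintro _ ⟨⟨y, rfl⟩, h⟩
      exact congrArg (diag ιI ιΛ)
        (eq_of_isInverseOf ((isInverseOf_iff _ _).1 h) (sinv_spec p.mid))

theorem isQuasiIdeal_srange : IsQuasiIdeal (diagHom ιI ιΛ).srange := by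
  rintro _ ⟨x, rfl⟩ p _ ⟨y, rfl⟩
  exact ⟨_, (diag_mul_mul_diag x y p).symm⟩

end TripleProduct

/-! ### Inverses in orthodox semigroups. -/

namespace IsOrthodox

variable {S : Type*} [Semigroup S]

/-- The product of the idempotents `a' a` and `b b'` occurs twice in a row between `a` and `b`, and
orthodoxy collapses the repetition. -/
theorem isInverseOf_mul (hS : IsOrthodox S) {a a' b b' : S} (ha : IsInverseOf a a')
    (hb : IsInverseOf b b') : IsInverseOf (a * b) (b' * a') := by
  have key : ∀ {a a' b b' : S}, IsInverseOf a a' → IsInverseOf b b' →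
      a * b * (b' * a') * (a * b) = a * b := fun {a a' b b'} ha hb =>
    calc a * b * (b' * a') * (a * b) = a * a' * a * b * (b' * a') * (a * (b * b' * b)) := by
          rw [ha.1, hb.1]
      _ = a * (a' * a * (b * b') * (a' * a * (b * b'))) * b := by simp only [mul_assoc]
      _ = a * (a' * a * (b * b')) * b := by
          rw [hS.2 _ _ ha.symm.isIdempotentElem_mul hb.isIdempotentElem_mul]
      _ = a * a' * a * (b * b' * b) := by simp only [mul_assoc]
      _ = a * b := by rw [ha.1, hb.1]
  exact ⟨key ha hb, key hb.symm ha.symm⟩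

/-- `e' = (e' e)(e e')` is a product of two idempotents. -/
theorem isIdempotentElem_of_isInverseOf (hS : IsOrthodox S) {e e' : S} (he : IsIdempotentElem e)
    (h : IsInverseOf e e') : IsIdempotentElem e' := by
  have h' : e' * e * (e * e') = e' := by
    rw [mul_assoc, ← mul_assoc e e, he.eq, ← mul_assoc, h.2]
  rw [← h']
  exact hS.2 _ _ h.symm.isIdempotentElem_mul h.isIdempotentElem_mul

end IsOrthodox

/-! ### The map `x ↦ x°` and sandwiches in a quasi-ideal transversal. -/

namespace IsInverseTransversal

variable {S : Type*} [Semigroup S] (T : Subsemigroup S) [IsInverseTransversal T]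

/-- The unique inverse `x°` of `x` in the inverse transversal `T`. -/
noncomputable def tinv (x : S) : T :=
  ⟨(existsUnique_mem (T := T) x).choose, (existsUnique_mem (T := T) x).choose_spec.1.1⟩

variable {T}

theorem tinv_spec (x : S) : IsInverseOf x (tinv T x) :=
  (existsUnique_mem (T := T) x).choose_spec.1.2

theorem eq_tinv {x : S} {y : T} (h : IsInverseOf x y) : y = tinv T x :=
  Subtype.ext ((existsUnique_mem (T := T) x).unique ⟨y.2, h⟩ ⟨(tinv T x).2, tinv_spec x⟩)

theorem tinv_coe (t : T) : tinv T (t : S) = sinv t :=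
  (eq_tinv ((sinv_spec t).map (MulMemClass.subtype T))).symm

theorem mul_tinv_mul (x : S) : x * tinv T x * x = x := (tinv_spec x).1

theorem tinv_mul_tinv (x : S) : (tinv T x : S) * x * tinv T x = tinv T x := (tinv_spec x).2

theorem tinv_mul (hS : IsOrthodox S) (x y : S) : tinv T (x * y) = tinv T y * tinv T x :=
  (eq_tinv (hS.isInverseOf_mul (tinv_spec x) (tinv_spec y))).symm

theorem sinv_mul (hS : IsOrthodox S) (x y : T) : sinv (x * y) = sinv y * sinv x := by
  rw [← tinv_coe, MulMemClass.coe_mul, tinv_mul hS, tinv_coe, tinv_coe]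

theorem isIdempotentElem_tinv (hS : IsOrthodox S) {e : S} (he : IsIdempotentElem e) :
    IsIdempotentElem (tinv T e) :=
  Subtype.ext (hS.isIdempotentElem_of_isInverseOf he (tinv_spec e))

/-- In a quasi-ideal transversal `a s b = a s°° b` for `a`, `b` in the transversal. -/
theorem mul_mul_eq (hS : IsOrthodox S) (hT : IsQuasiIdeal T) (a b : T) (s : S) :
    (a : S) * s * b = (a * sinv (tinv T s) * b : T) := by
  obtain ⟨t, ht⟩ : ∃ t : T, (t : S) = a * s * b := ⟨⟨_, hT a a.2 s b b.2⟩, rfl⟩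
  -- Since `t` lies in `T`, it equals `(t°)⁻¹`; expand `(a s b)° = b⁻¹ s° a⁻¹` and invert again.
  rw [← ht, ← sinv_sinv t, ← tinv_coe t, ht, tinv_mul hS, tinv_mul hS, sinv_mul hS, sinv_mul hS,
    tinv_coe, tinv_coe, sinv_sinv, sinv_sinv]

theorem mul_mul_idem_eq (hS : IsOrthodox S) (hT : IsQuasiIdeal T) (a b : T) {e : S}
    (he : IsIdempotentElem e) : (a : S) * e * b = (a * tinv T e * b : T) := by
  rw [mul_mul_eq hS hT, sinv_eq_self (isIdempotentElem_tinv hS he)]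

/-- Writing `e f = e (e° f f°)` puts `f` in a sandwich, where it may be replaced by `f°`. Right
factors then commute with each other because the idempotents of `T` do. -/
theorem mul_eq_mul_tinv (hS : IsOrthodox S) (hT : IsQuasiIdeal T) {e f : S}
    (hf : IsIdempotentElem f) (he' : e * tinv T e = e)
    (hf' : f * tinv T f = f) : e * f = e * tinv T f := by
  have hi : (tinv T f : S) * tinv T f = tinv T f :=
    congrArg Subtype.val (isIdempotentElem_tinv hS hf).eq
  calc e * f = e * (tinv T e * f * tinv T f) := by
        rw [mul_assoc, hf', ← mul_assoc, he']
    _ = e * tinv T e * (tinv T f * tinv T f) := by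
        rw [mul_mul_idem_eq hS hT _ _ hf]; simp only [MulMemClass.coe_mul, mul_assoc]
    _ = e * tinv T f := by rw [he', hi]

theorem mul_eq_tinv_mul (hS : IsOrthodox S) (hT : IsQuasiIdeal T) {e f : S}
    (he : IsIdempotentElem e) (he' : tinv T e * e = e)
    (hf' : tinv T f * f = f) : e * f = tinv T e * f := by
  have hi : (tinv T e : S) * tinv T e = tinv T e :=
    congrArg Subtype.val (isIdempotentElem_tinv hS he).eq
  calc e * f = tinv T e * e * tinv T f * f := by
        rw [mul_assoc _ _ f, hf', he']
    _ = tinv T e * tinv T e * (tinv T f * f) := by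
        rw [mul_mul_idem_eq hS hT _ _ he]; simp only [MulMemClass.coe_mul, mul_assoc]
    _ = tinv T e * f := by rw [hf', hi]

theorem tinv_comm (hS : IsOrthodox S) {e f : S} (he : IsIdempotentElem e)
    (hf : IsIdempotentElem f) : (tinv T e : S) * tinv T f = tinv T f * tinv T e :=
  congrArg Subtype.val
    ((isIdempotentElem_tinv hS he).mul_comm_of_inverse (isIdempotentElem_tinv hS hf))

/-! ### The two normal bands. -/

/-- The left normal band `I` of the idempotents `e` with `e e° = e`. -/
def leftBand (hS : IsOrthodox S) (hT : IsQuasiIdeal T) : Subsemigroup S where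
  carrier := {e | IsIdempotentElem e ∧ e * tinv T e = e}
  mul_mem' := by
    rintro e f ⟨he, he'⟩ ⟨hf, hf'⟩
    refine ⟨hS.2 e f he hf, ?_⟩
    -- `e f f° e° = e f e° = e f° e° = e e° f° = e f° = e f`.
    rw [tinv_mul hS, MulMemClass.coe_mul, mul_assoc, ← mul_assoc f, hf',
      mul_eq_mul_tinv hS hT hf he' hf', ← mul_assoc,
      mul_eq_mul_tinv hS hT hf he' hf', mul_assoc, tinv_comm hS hf he, ← mul_assoc, he']

/-- The right normal band `Λ` of the idempotents `f` with `f° f = f`. -/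
def rightBand (hS : IsOrthodox S) (hT : IsQuasiIdeal T) : Subsemigroup S where
  carrier := {f | IsIdempotentElem f ∧ tinv T f * f = f}
  mul_mem' := by
    rintro e f ⟨he, he'⟩ ⟨hf, hf'⟩
    refine ⟨hS.2 e f he hf, ?_⟩
    rw [tinv_mul hS, MulMemClass.coe_mul, mul_assoc, ← mul_assoc _ e, he',
      mul_eq_tinv_mul hS hT he he' hf', ← mul_assoc, tinv_comm hS hf he, mul_assoc, hf']

theorem idem_mul_tinv {e : T} (he : IsIdempotentElem e) : (e : S) * tinv T (e : S) = e := by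
  rw [tinv_coe, sinv_eq_self he]; exact congrArg Subtype.val he

theorem tinv_mul_idem {e : T} (he : IsIdempotentElem e) : tinv T (e : S) * (e : S) = e := by
  rw [tinv_coe, sinv_eq_self he]; exact congrArg Subtype.val he

variable (hS : IsOrthodox S) (hT : IsQuasiIdeal T)

/-- The inclusion of the idempotents of `T` in the left normal band. -/
def toLeftBand : idemSubsemigroup T →ₙ* leftBand hS hT where
  toFun e := ⟨(e : T), congrArg Subtype.val e.2, idem_mul_tinv e.2⟩
  map_mul' _ _ := rfl

/-- The inclusion of the idempotents of `T` in the right normal band. -/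
def toRightBand : idemSubsemigroup T →ₙ* rightBand hS hT where
  toFun e := ⟨(e : T), congrArg Subtype.val e.2, tinv_mul_idem e.2⟩
  map_mul' _ _ := rfl

theorem coe_toLeftBand (e : idemSubsemigroup T) : (toLeftBand hS hT e : S) = (e : T) := rfl

theorem coe_toRightBand (e : idemSubsemigroup T) : (toRightBand hS hT e : S) = (e : T) := rfl

theorem tinv_mul_of_mul_tinv {e : S} (h : e * tinv T e = e) : tinv T e * e = tinv T e := by
  have := tinv_mul_tinv (T := T) e
  rwa [mul_assoc, h] at this

theorem mul_tinv_of_tinv_mul {e : S} (h : tinv T e * e = e) : e * tinv T e = tinv T e := by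
  have := tinv_mul_tinv (T := T) e
  rwa [h] at this

theorem isNormalBandPair : IsNormalBandPair (toLeftBand hS hT) (toRightBand hS hT) where
  left_normal := by
    refine ⟨fun x => Subtype.ext x.2.1, fun x y z => Subtype.ext ?_⟩
    have h : ∀ a b : leftBand hS hT, (a : S) * b = a * tinv T (b : S) := fun a b =>
      mul_eq_mul_tinv hS hT b.2.1 a.2.2 b.2.2
    calc (x : S) * y * z = x * y * tinv T (z : S) := h (x * y) z
      _ = x * z * tinv T (y : S) := by
          rw [h x y, h x z, mul_assoc, mul_assoc, tinv_comm hS y.2.1 z.2.1]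
      _ = x * z * y := (h (x * z) y).symm
  right_normal := by
    refine ⟨fun x => Subtype.ext x.2.1, fun x y z => Subtype.ext ?_⟩
    have h : ∀ a b : rightBand hS hT, (a : S) * b = tinv T (a : S) * b := fun a b =>
      mul_eq_tinv_mul hS hT a.2.1 a.2.2 b.2.2
    change (x : S) * y * z = y * x * z
    calc (x : S) * y * z = x * (y * z) := mul_assoc _ _ _
      _ = tinv T (x : S) * (y * z) := h x (y * z)
      _ = tinv T (y : S) * (x * z) := by
          rw [h y z, h x z, ← mul_assoc, ← mul_assoc, tinv_comm hS y.2.1 x.2.1]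
      _ = y * (x * z) := (h y (x * z)).symm
      _ = y * x * z := (mul_assoc _ _ _).symm
  left_union i := ⟨⟨tinv T (i : S), isIdempotentElem_tinv hS i.2.1⟩,
    greenL_of_mul_eq (Subtype.ext i.2.2) (Subtype.ext (tinv_mul_of_mul_tinv i.2.2))⟩
  right_union l := ⟨⟨tinv T (l : S), isIdempotentElem_tinv hS l.2.1⟩,
    greenR_of_mul_eq (Subtype.ext (mul_tinv_of_tinv_mul l.2.2)) (Subtype.ext l.2.2)⟩
  left_transversal := by
    refine ⟨fun a b h =>
      Subtype.ext (Subtype.ext (congrArg (fun x : leftBand hS hT => (x : S)) h)), fun x => ?_⟩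
    refine ⟨⟨tinv T (x : S), isIdempotentElem_tinv hS x.2.1⟩, ?_, fun e he => ?_⟩
    · exact ⟨Subtype.ext (mul_tinv_mul _), Subtype.ext (tinv_mul_tinv _)⟩
    · exact Subtype.ext (eq_tinv (he.map (MulMemClass.subtype (leftBand hS hT))))
  right_transversal := by
    refine ⟨fun a b h =>
      Subtype.ext (Subtype.ext (congrArg (fun x : rightBand hS hT => (x : S)) h)), fun x => ?_⟩
    refine ⟨⟨tinv T (x : S), isIdempotentElem_tinv hS x.2.1⟩, ?_, fun e he => ?_⟩
    · exact ⟨Subtype.ext (mul_tinv_mul _), Subtype.ext (tinv_mul_tinv _)⟩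
    · exact Subtype.ext (eq_tinv (he.map (MulMemClass.subtype (rightBand hS hT))))

/-! ### The isomorphism of `S` onto `W`. -/

theorem tinv_mul_tinv_self (hS : IsOrthodox S) (x : S) :
    tinv T (x * tinv T x) = sinv (tinv T x) * tinv T x := by
  rw [tinv_mul hS, tinv_coe]

theorem tinv_tinv_mul_self (hS : IsOrthodox S) (x : S) :
    tinv T (tinv T x * x) = tinv T x * sinv (tinv T x) := by
  rw [tinv_mul hS, tinv_coe]

theorem mul_tinv_mem_leftBand (x : S) : x * tinv T x ∈ leftBand hS hT := by
  refine ⟨(tinv_spec x).isIdempotentElem_mul, ?_⟩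
  rw [tinv_mul_tinv_self hS, mul_assoc, ← MulMemClass.coe_mul, ← mul_assoc,
    (sinv_spec (tinv T x)).1]

theorem tinv_mul_mem_rightBand (x : S) : tinv T x * x ∈ rightBand hS hT := by
  refine ⟨(tinv_spec x).symm.isIdempotentElem_mul, ?_⟩
  rw [tinv_tinv_mul_self hS, ← mul_assoc, ← MulMemClass.coe_mul, (sinv_spec (tinv T x)).1]

theorem coe_leftIdem_sinv (t : T) : ((leftIdem (sinv t) : T) : S) = sinv t * t := by
  rw [leftIdem_sinv]; rfl

theorem coe_rightIdem_sinv (t : T) : ((rightIdem (sinv t) : T) : S) = t * sinv t := by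
  rw [rightIdem_sinv]; rfl

/-- The triple `(x x°, x°°, x° x)`. -/
noncomputable def toTriple (x : S) : TripleProduct (toLeftBand hS hT) (toRightBand hS hT) where
  left := ⟨x * tinv T x, mul_tinv_mem_leftBand hS hT x⟩
  mid := sinv (tinv T x)
  right := ⟨tinv T x * x, tinv_mul_mem_rightBand hS hT x⟩
  left_mem := by
    have h := (mul_tinv_mem_leftBand hS hT x).2
    have h' := tinv_mul_of_mul_tinv h
    rw [tinv_mul_tinv_self hS] at h h'
    apply greenL_of_mul_eq <;> apply Subtype.ext <;>
      simpa only [MulMemClass.coe_mul, coe_toLeftBand, coe_leftIdem_sinv]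
  right_mem := by
    have h := (tinv_mul_mem_rightBand hS hT x).2
    have h' := mul_tinv_of_tinv_mul h
    rw [tinv_tinv_mul_self hS] at h h'
    apply greenR_of_mul_eq <;> apply Subtype.ext <;>
      simpa only [MulMemClass.coe_mul, coe_toRightBand, coe_rightIdem_sinv]

theorem toTriple_mul (x y : S) :
    toTriple hS hT (x * y) = toTriple hS hT x * toTriple hS hT y := by
  have hm : sinv (tinv T (x * y)) = sinv (tinv T x) * sinv (tinv T y) := by
    rw [tinv_mul hS, sinv_mul hS]
  -- After `x = x x° x` or `y = y y° y` is inserted, both outer coordinates of the image of `x y`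
  -- contain this sandwich.
  have key : (tinv T x : S) * (x * y) * tinv T y =
      tinv T x * sinv (tinv T x) * sinv (tinv T y) * tinv T y := by
    rw [mul_mul_eq hS hT, hm]
    simp only [MulMemClass.coe_mul, mul_assoc]
  apply TripleProduct.ext
  · apply Subtype.ext
    change x * y * tinv T (x * y) =
      x * tinv T x * ((leftIdem (sinv (tinv T x) * sinv (tinv T y)) : T) : S)
    rw [← hm, coe_leftIdem_sinv, hm, tinv_mul hS]
    calc x * y * (tinv T y * tinv T x : T)
        = x * tinv T x * x * y * (tinv T y * tinv T x : T) := by rw [mul_tinv_mul]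
      _ = x * (tinv T x * (x * y) * tinv T y) * tinv T x := by
          simp only [MulMemClass.coe_mul, mul_assoc]
      _ = _ := by rw [key]; simp only [MulMemClass.coe_mul, mul_assoc]
  · exact hm
  · apply Subtype.ext
    change tinv T (x * y) * (x * y) =
      ((rightIdem (sinv (tinv T x) * sinv (tinv T y)) : T) : S) * (tinv T y * y)
    rw [← hm, coe_rightIdem_sinv, hm, tinv_mul hS]
    calc (tinv T y * tinv T x : T) * (x * y)
        = (tinv T y * tinv T x : T) * (x * (y * tinv T y * y)) := by rw [mul_tinv_mul]
      _ = tinv T y * (tinv T x * (x * y) * tinv T y) * y := by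
          simp only [MulMemClass.coe_mul, mul_assoc]
      _ = _ := by rw [key]; simp only [MulMemClass.coe_mul, mul_assoc]

/-- The element `e x f` of `S` given by a triple `(e, x, f)`. -/
def ofTriple (p : TripleProduct (toLeftBand hS hT) (toRightBand hS hT)) : S :=
  p.left * (p.mid : S) * p.right

theorem ofTriple_toTriple (x : S) : ofTriple hS hT (toTriple hS hT x) = x := by
  have h : (tinv T x : S) * sinv (tinv T x) * tinv T x = tinv T x :=
    congrArg Subtype.val (sinv_spec (tinv T x)).1
  calc x * tinv T x * sinv (tinv T x) * (tinv T x * x)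
      = x * (tinv T x * sinv (tinv T x) * tinv T x) * x := by simp only [mul_assoc]
    _ = x := by rw [h, mul_tinv_mul]

theorem toTriple_ofTriple (p : TripleProduct (toLeftBand hS hT) (toRightBand hS hT)) :
    toTriple hS hT (ofTriple hS hT p) = p := by
  obtain ⟨e, m, f, hl, hr⟩ := p
  have he : (e : S) * (m * sinv m) = e :=
    congrArg Subtype.val (hl.mul_eq_left ((isIdempotentElem_idem _).map (toLeftBand hS hT)))
  have he' : ((m : S) * sinv m) * e = m * sinv m :=
    congrArg Subtype.val (hl.symm.mul_eq_left (Subtype.ext e.2.1))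
  have hf : ((sinv m : T) * m : S) * f = f :=
    congrArg Subtype.val (hr.mul_eq_left ((isIdempotentElem_idem _).map (toRightBand hS hT)))
  have hf' : (f : S) * (sinv m * m) = sinv m * m :=
    congrArg Subtype.val (hr.symm.mul_eq_left (Subtype.ext f.2.1))
  -- The Green relations identify `m m⁻¹` with `e°` and `m⁻¹ m` with `f°`, whence `(e m f)° = f° m⁻¹
  -- e° = m⁻¹`.
  have hte : m * sinv m = tinv T (e : S) := eq_tinv
    ⟨by rw [MulMemClass.coe_mul, he, e.2.1.eq],
      by rw [MulMemClass.coe_mul, he', ← MulMemClass.coe_mul]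
         exact congrArg Subtype.val (sinv_spec m).isIdempotentElem_mul⟩
  have htf : sinv m * m = tinv T (f : S) := eq_tinv
    ⟨by rw [MulMemClass.coe_mul, hf', hf],
      by rw [MulMemClass.coe_mul, mul_assoc, hf', ← MulMemClass.coe_mul]
         exact congrArg Subtype.val (sinv_spec m).symm.isIdempotentElem_mul⟩
  have hm : tinv T ((e : S) * m * f) = sinv m := by
    rw [tinv_mul hS, tinv_mul hS, ← hte, ← htf, tinv_coe, ← mul_assoc, ← mul_assoc,
      (sinv_spec m).2, (sinv_spec m).2]
  apply TripleProduct.ext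
  · apply Subtype.ext
    change (e : S) * m * f * tinv T ((e : S) * m * f) = e
    -- The sandwich `m f m⁻¹` equals `m f° m⁻¹ = m m⁻¹`, which `e` absorbs.
    rw [hm, mul_assoc, mul_assoc, ← mul_assoc (m : S), mul_mul_idem_eq hS hT _ _ f.2.1, ← htf,
      ← mul_assoc m, (sinv_spec m).1, MulMemClass.coe_mul, he]
  · change sinv (tinv T ((e : S) * m * f)) = m
    rw [hm, sinv_sinv]
  · apply Subtype.ext
    change tinv T ((e : S) * m * f) * ((e : S) * m * f) = f
    rw [hm, ← mul_assoc, ← mul_assoc, mul_mul_idem_eq hS hT _ _ e.2.1, ← hte,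
      ← mul_assoc (sinv m), (sinv_spec m).2, MulMemClass.coe_mul, hf]

/-- The isomorphism `x ↦ (x x°, x°°, x° x)` of `S` onto `W`. -/
noncomputable def tripleEquiv : S ≃* TripleProduct (toLeftBand hS hT) (toRightBand hS hT) where
  toFun := toTriple hS hT
  invFun := ofTriple hS hT
  left_inv := ofTriple_toTriple hS hT
  right_inv := toTriple_ofTriple hS hT
  map_mul' := toTriple_mul hS hT

theorem toTriple_coe (t : T) :
    toTriple hS hT (t : S) = TripleProduct.diag (toLeftBand hS hT) (toRightBand hS hT) t := by
  apply TripleProduct.ext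
  · apply Subtype.ext
    change (t : S) * tinv T (t : S) = (t * sinv t : T)
    rw [tinv_coe, MulMemClass.coe_mul]
  · change sinv (tinv T (t : S)) = t
    rw [tinv_coe, sinv_sinv]
  · apply Subtype.ext
    change (tinv T (t : S) : S) * t = (sinv t * t : T)
    rw [tinv_coe, MulMemClass.coe_mul]

end IsInverseTransversal

theorem mainTheorem10 :
    (∀ (S₀ : Type v) (I : Type w) (Λ : Type z) [Semigroup S₀] [IsInverseSemigroup S₀]
      [Semigroup I] [Semigroup Λ]
      (ιI : idemSubsemigroup S₀ →ₙ* I) (ιΛ : idemSubsemigroup S₀ →ₙ* Λ),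
      IsNormalBandPair ιI ιΛ →
        IsOrthodox (TripleProduct ιI ιΛ) ∧
        ∃ T : Subsemigroup (TripleProduct ιI ιΛ),
          IsInverseTransversal T ∧ IsQuasiIdeal T ∧
          ∃ φ : S₀ ≃* T, ∀ x : S₀, (φ x : TripleProduct ιI ιΛ) = TripleProduct.diag ιI ιΛ x) ∧
    (∀ (S : Type u) [Semigroup S] (T : Subsemigroup S) [IsInverseTransversal T],
      IsOrthodox S → IsQuasiIdeal T →
        ∃ (I : Type u) (Λ : Type u) (_ : Semigroup I) (_ : Semigroup Λ)
          (ιI : idemSubsemigroup T →ₙ* I) (ιΛ : idemSubsemigroup T →ₙ* Λ),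
          IsNormalBandPair ιI ιΛ ∧
          ∃ ψ : S ≃* TripleProduct ιI ιΛ, ∀ x : T, ψ (x : S) = TripleProduct.diag ιI ιΛ x) := by

  constructor
  · intro S₀ I Λ _ _ _ _ ιI ιΛ _
    exact ⟨TripleProduct.isOrthodox, (TripleProduct.diagHom ιI ιΛ).srange,
      TripleProduct.isInverseTransversal_srange, TripleProduct.isQuasiIdeal_srange,
      TripleProduct.diagEquiv ιI ιΛ, fun _ => rfl⟩
  · intro S _ T _ hS hT
    exact ⟨IsInverseTransversal.leftBand hS hT, IsInverseTransversal.rightBand hS hT,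
      inferInstance, inferInstance, IsInverseTransversal.toLeftBand hS hT,
      IsInverseTransversal.toRightBand hS hT, IsInverseTransversal.isNormalBandPair hS hT,
      IsInverseTransversal.tripleEquiv hS hT, IsInverseTransversal.toTriple_coe hS hT⟩
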